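/- Let $X=\{0,1\}$, let $X^*$ be the rooted binary tree of finite words over $X$ (a word $u$ being joined to its children $ux$, $x\in X$), and let its automorphism group act on the right. For tree automorphisms $g_0,g_1$ let $\langle\!\langle g_0,g_1\rangle\!\rangle$ be the automorphism $0w\mapsto 0\,w^{g_0}$, $1w\mapsto 1\,w^{g_1}$, and let $\sigma$ exchange the first letters $0$ and $1$ and fix all other letters. Let $n\ge 1$ and let $v=x_1x_2\ldots x_{n-1}$ be a word of length $n-1$ over $X$. Let $K(v)$ be the group of tree automorphisms generated by $a_1,\ldots,a_n$, where $$a_1=\langle\!\langle 1,a_n\rangle\!\rangle\sigma,\qquad a_{i+1}=\begin{cases}\langle\!\langle a_i,1\rangle\!\rangle & \text{if } x_i=0,\\ \langle\!\langle 1,a_i\rangle\!\rangle & \text{if } x_i=1,\end{cases}\qquad 1\le i<n.$$ In any group write $g^h=h^{-1}gh$ and $[g,h]=g^{-1}h^{-1}gh$, and write $g^{k_1h_1+\cdots+k_rh_r}=(g^{k_1})^{h_1}\cdots(g^{k_r})^{h_r}$ for $k_i\in\mathbb Z$ and group elements $h_i$. Write $p(t)=x_{n-1}t+x_{n-2}t^2+\cdots+x_1t^{n-1}$,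 so that $a^{p(t)}=(a^{x_{n-1}})^{t}(a^{x_{n-2}})^{t^2}\cdots(a^{x_1})^{t^{n-1}}$, with the factors in this order, and let $\Gamma$ be the finitely presented group $$\Gamma=\Big\langle a,t\ \Big|\ a^{t^n-2a^{p(t)}},\ \big[a^{t^i},a^{t^ja}\big],\ \big[a^{t^i},a^{t^ja^3}\big]\ \text{ for all } 1\le i,j<n\Big\rangle,$$ where $a^{t^n-2a^{p(t)}}=a^{t^n}\,(a^{-2})^{a^{p(t)}}$. Theorem. There is an injective endomorphism $\varphi$ of $K(v)$ with $\varphi(a_n)=a_1^2$ and, for $1\le i<n$, $\varphi(a_i)=a_{i+1}$ if $x_i=0$ and $\varphi(a_i)=a_1a_{i+1}a_1^{-1}$ if $x_i=1$. The group $\Gamma$ is isomorphic to the ascending HNN extension $\langle K(v),t\mid t^{-1}gt=\varphi(g)\text{ for all } g\in K(v)\rangle$ of $K(v)$ by $\varphi$, through an isomorphism that sends $a$ to $a_1^{-1}$ and $t$ to the stable letter $t$. This isomorphism carries the subgroup $\langle a,a^t,\ldots,a^{t^{n-1}}\rangle$ of $\Gamma$ onto the canonical copy of $K(v)$ in the extension;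 in particular $K(v)$ is isomorphic to that subgroup. -/

import Mathlib

namespace KneadingGroup

/-- In the rooted binary tree of finite words over `{0, 1}` (`false` is `0`, `true` is `1`),
the word `w` is a child of the word `u` when `w = ux` for a letter `x`. -/
def Child (u w : List Bool) : Prop := ∃ x : Bool, w = u ++ [x]

/-- The automorphism group of the rooted binary tree, acting on the *right*: it is the opposite
of the group of child-preserving bijections under composition, so that `g * h` means
"first `g`, then `h`". -/
abbrev TreeAut : Type := (RelIso Child Child)ᵐᵒᵖ

/-- The image `w ^ g` of the word `w` under the right action of `g`. -/
def TreeAut.app (w : List Bool) (g : TreeAut) : List Bool := g.unop w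

/-- The action on words of the `(i+1)`-st generator, i.e. of
`a₁ = ⟨1, a_n⟩σ`, and `a_{i+1} = ⟨a_i, 1⟩` or `⟨1, a_i⟩` according to `x_i = 0` or `x_i = 1`.
Here `n = m + 1`, the index `i : Fin (m + 1)` stands for the generator `a_{i+1}`, and the letter
`x_{i+1}` is `v i`. -/
def act {m : ℕ} (v : Fin m → Bool) : List Bool → Fin (m + 1) → List Bool
  | [], _ => []
  | b :: w, i =>
    Fin.cases (motive := fun _ => List Bool)
      (if b = false then true :: w else false :: act v w (Fin.last m))
      (fun j => if b = v j then b :: act v w j.castSucc else b :: w) i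

/-- The action on words of the inverse of the `(i+1)`-st generator. -/
def actInv {m : ℕ} (v : Fin m → Bool) : List Bool → Fin (m + 1) → List Bool
  | [], _ => []
  | b :: w, i =>
    Fin.cases (motive := fun _ => List Bool)
      (if b = true then false :: w else true :: actInv v w (Fin.last m))
      (fun j => if b = v j then b :: actInv v w j.castSucc else b :: w) i

theorem actInv_act {m : ℕ} (v : Fin m → Bool) (w : List Bool) :
    ∀ i, actInv v (act v w i) i = w := by
  induction w with
  | nil => intro i; rfl
  | cons b w ih =>
    intro i
    refine Fin.cases ?_ (fun j => ?_) i
    · cases b <;> simp [act, actInv, ih]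
    · by_cases h : b = v j <;> simp [act, actInv, ih, h]

theorem act_actInv {m : ℕ} (v : Fin m → Bool) (w : List Bool) :
    ∀ i, act v (actInv v w i) i = w := by
  induction w with
  | nil => intro i; rfl
  | cons b w ih =>
    intro i
    refine Fin.cases ?_ (fun j => ?_) i
    · cases b <;> simp [act, actInv, ih]
    · by_cases h : b = v j <;> simp [act, actInv, ih, h]

theorem child_cons {b : Bool} {u w : List Bool} (h : Child u w) : Child (b :: u) (b :: w) := by
  obtain ⟨x, rfl⟩ := h
  exact ⟨x, rfl⟩

theorem child_act {m : ℕ} (v : Fin m → Bool) (x : Bool) (u : List Bool) :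
    ∀ i, Child (act v u i) (act v (u ++ [x]) i) := by
  induction u with
  | nil =>
    intro i
    refine Fin.cases ?_ (fun j => ?_) i
    · cases x <;> simp [act, Child]
    · by_cases h : x = v j <;> simp [act, Child, h]
  | cons b u ih =>
    intro i
    refine Fin.cases ?_ (fun j => ?_) i
    · cases b
      · exact child_cons ⟨x, rfl⟩
      · exact child_cons (ih _)
    · by_cases h : b = v j
      · simpa [act, h] using child_cons (ih j.castSucc)
      · simpa [act, h] using child_cons ⟨x, rfl⟩

theorem child_actInv {m : ℕ} (v : Fin m → Bool) (x : Bool) (u : List Bool) :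
    ∀ i, Child (actInv v u i) (actInv v (u ++ [x]) i) := by
  induction u with
  | nil =>
    intro i
    refine Fin.cases ?_ (fun j => ?_) i
    · cases x <;> simp [actInv, Child]
    · by_cases h : x = v j <;> simp [actInv, Child, h]
  | cons b u ih =>
    intro i
    refine Fin.cases ?_ (fun j => ?_) i
    · cases b
      · exact child_cons (ih _)
      · exact child_cons ⟨x, rfl⟩
    · by_cases h : b = v j
      · simpa [actInv, h] using child_cons (ih j.castSucc)
      · simpa [actInv, h] using child_cons ⟨x, rfl⟩

/-- The tree automorphism `a_{i+1}`. -/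
def aut {m : ℕ} (v : Fin m → Bool) (i : Fin (m + 1)) : TreeAut :=
  MulOpposite.op
    { toFun := fun w => act v w i
      invFun := fun w => actInv v w i
      left_inv := fun w => actInv_act v w i
      right_inv := fun w => act_actInv v w i
      map_rel_iff' := by
        intro u w
        constructor
        · rintro ⟨x, hx⟩
          change act v w i = act v u i ++ [x] at hx
          have h := child_actInv v x (act v u i) i
          rw [← hx] at h
          simpa [actInv_act] using h
        · rintro ⟨x, rfl⟩
          exact child_act v x u i }

section Recursion

variable {m : ℕ} (v : Fin m → Bool) (w : List Bool) (j : Fin m)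

theorem app_nil (i : Fin (m + 1)) : TreeAut.app [] (aut v i) = [] := rfl

theorem app_aut_zero_false : TreeAut.app (false :: w) (aut v 0) = true :: w := rfl

theorem app_aut_zero_true :
    TreeAut.app (true :: w) (aut v 0) = false :: TreeAut.app w (aut v (Fin.last m)) := rfl

theorem app_aut_succ_eq :
    TreeAut.app (v j :: w) (aut v j.succ) = v j :: TreeAut.app w (aut v j.castSucc) := by
  simp [TreeAut.app, aut, act]

theorem app_aut_succ_ne {b : Bool} (h : b ≠ v j) :
    TreeAut.app (b :: w) (aut v j.succ) = b :: w := by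
  simp [TreeAut.app, aut, act, h]

end Recursion

/-- The group `K(v)` generated by the tree automorphisms `a₁, …, a_n`. -/
def K {m : ℕ} (v : Fin m → Bool) : Subgroup TreeAut := Subgroup.closure (Set.range (aut v))

/-- The generator `a_{i+1}` as an element of `K(v)`. -/
def gen {m : ℕ} (v : Fin m → Bool) (i : Fin (m + 1)) : K v :=
  ⟨aut v i, Subgroup.subset_closure ⟨i, rfl⟩⟩

/-- `g ^ h = h⁻¹ g h`. -/
def conj {G : Type*} [Group G] (g h : G) : G := h⁻¹ * g * h

/-- `[g, h] = g⁻¹ h⁻¹ g h`. -/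
def comm {G : Type*} [Group G] (g h : G) : G := g⁻¹ * h⁻¹ * g * h

/-- The element `a^{p(t)} = (a^{x_{n-1}})^t (a^{x_{n-2}})^{t²} ⋯ (a^{x₁})^{t^{n-1}}`
for `p(t) = x_{n-1} t + x_{n-2} t² + ⋯ + x₁ t^{n-1}`, the factors being in this order. -/
def powP {G : Type*} [Group G] {m : ℕ} (v : Fin m → Bool) (a t : G) : G :=
  (List.ofFn fun j : Fin m =>
    conj (a ^ (if v j.rev = true then 1 else 0 : ℤ)) (t ^ (j.val + 1))).prod

/-- The two letters of the finite presentation. -/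
inductive Letter : Type
  | a : Letter
  | t : Letter

/-- The defining relators: `a^{t^n - 2a^{p(t)}} = a^{t^n} (a^{-2})^{a^{p(t)}}`, and
`[a^{t^i}, a^{t^j a}]` and `[a^{t^i}, a^{t^j a³}]` for `1 ≤ i, j < n`, where `n = m + 1`. -/
def rels {m : ℕ} (v : Fin m → Bool) : Set (FreeGroup Letter) :=
  let a : FreeGroup Letter := FreeGroup.of Letter.a
  let t : FreeGroup Letter := FreeGroup.of Letter.t
  {conj a (t ^ (m + 1)) * conj (a ^ (-2 : ℤ)) (powP v a t)}
    ∪ {r | ∃ i j : ℕ, 1 ≤ i ∧ i < m + 1 ∧ 1 ≤ j ∧ j < m + 1 ∧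
        r = comm (conj a (t ^ i)) (conj a (t ^ j * a))}
    ∪ {r | ∃ i j : ℕ, 1 ≤ i ∧ i < m + 1 ∧ 1 ≤ j ∧ j < m + 1 ∧
        r = comm (conj a (t ^ i)) (conj a (t ^ j * a ^ 3))}

/-- The group with generators `a, t` and relators `rels v`. -/
abbrev Gam {m : ℕ} (v : Fin m → Bool) : Type := PresentedGroup (rels v)

/-- The generator `a` of the presented group. -/
def ga {m : ℕ} (v : Fin m → Bool) : Gam v := PresentedGroup.of Letter.a

/-- The generator `t` of the presented group. -/
def gt {m : ℕ} (v : Fin m → Bool) : Gam v := PresentedGroup.of Letter.t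

/-- The subgroup `⟨a, a^t, …, a^{t^{n-1}}⟩` of the presented group. -/
def H {m : ℕ} (v : Fin m → Bool) : Subgroup (Gam v) :=
  Subgroup.closure (Set.range fun i : Fin (m + 1) => conj (ga v) (gt v ^ i.val))

/-- The ascending HNN extension `⟨G, t | t⁻¹ g t = φ(g), g ∈ G⟩` of `G` by an injective
endomorphism `φ`: the associated subgroups are `φ(G)` and `G`, and `t φ(g) t⁻¹ = g`. -/
abbrev AscendingHNN {G : Type*} [Group G] (φ : G →* G) (hφ : Function.Injective φ) : Type _ :=
  HNNExtension G φ.range ⊤ ((MonoidHom.ofInjective hφ).symm.trans Subgroup.topEquiv.symm)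

theorem AscendingHNN.conj_of {G : Type*} [Group G] (φ : G →* G) (hφ : Function.Injective φ)
    (g : G) :
    conj (HNNExtension.of g : AscendingHNN φ hφ) HNNExtension.t = HNNExtension.of (φ g) := by
  have h := HNNExtension.t_mul_of
    (φ := (MonoidHom.ofInjective hφ).symm.trans Subgroup.topEquiv.symm)
    (MonoidHom.ofInjective hφ g)
  simp only [MonoidHom.ofInjective_apply, MulEquiv.trans_apply, MulEquiv.symm_apply_apply,
    Subgroup.topEquiv_symm_apply_coe] at h
  rw [conj, mul_assoc, ← h, inv_mul_cancel_left]

end KneadingGroup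

namespace KneadingGroup

/-! Write a = a₁⁻¹, e(g) for the exponent sum of a_n in g, and P = a^{p(t)}. The proof rests on an
induction over the words that are trivial in K(v) (`trivial_word_induction`): a property of such
words holds as soon as it holds for the empty word, survives insertion of x x⁻¹, and passes from the
two first-level sections of a trivial word to the word itself. The lengths of the sections add up to
the length of the word, so a minimal counterexample loses no letter under repeated sections.
Rigidity then makes all its letters distinct, while triviality makes each letter occur an even
number of times.

One use shows that exponent sums vanish on trivial words. Hence φ(g) = ⟨g, a_n^{e(g)}⟩ is well
defined, and it is injective because its left coordinate is g.

The other use gives a homomorphism from K(v) to Γ. In any group with elements a, t satisfying the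
relators, let c_i obey the recursion of the a_i with conjugation by t in place of φ. Then
`wordEval_eq` rewrites the value of a word in the c_i through the values of its sections, imitating
g = ⟨g₀, g₁⟩σ^s = φ(g₀) a^{2e(g₀)} φ(g₁)^{a⁻¹} a^s. This needs the "left" elements to commute with
the "right" ones, that is, B = ⟨a^t, …, a^{t^{n-1}}⟩ with every B^{a^k}, k odd. The relators provide
only k = 1 and k = 3; `commute_conj_odd` derives the rest.

Conversely the relators hold in the HNN extension, where the commutators are between ⟨*, 1⟩ and ⟨1,
*⟩. The two resulting homomorphisms are mutually inverse. -/

/-- The value of a word in the letters `ι` and their inverses (`true` marks the letter itself). -/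
def wordEval {ι G : Type*} [Group G] (f : ι → G) (w : List (ι × Bool)) : G :=
  (w.map fun x => cond x.2 (f x.1) (f x.1)⁻¹).prod

section WordEval

variable {ι G : Type*} [Group G] (f : ι → G)

@[simp] theorem wordEval_nil : wordEval f [] = 1 := rfl

@[simp] theorem wordEval_cons (x : ι × Bool) (w : List (ι × Bool)) :
    wordEval f (x :: w) = cond x.2 (f x.1) (f x.1)⁻¹ * wordEval f w := by
  simp [wordEval]

@[simp] theorem wordEval_append (u w : List (ι × Bool)) :
    wordEval f (u ++ w) = wordEval f u * wordEval f w := by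
  simp [wordEval]

theorem wordEval_cancel (u w : List (ι × Bool)) (i : ι) (s : Bool) :
    wordEval f (u ++ (i, s) :: (i, !s) :: w) = wordEval f (u ++ w) := by
  cases s <;> simp

theorem lift_mk_eq_wordEval (w : List (ι × Bool)) :
    FreeGroup.lift f (FreeGroup.mk w) = wordEval f w := FreeGroup.lift_mk

theorem map_wordEval {G' : Type*} [Group G'] (F : G →* G') (w : List (ι × Bool)) :
    F (wordEval f w) = wordEval (fun i => F (f i)) w := by
  induction w with
  | nil => simp
  | cons x w ih => rcases x with ⟨i, _ | _⟩ <;> simp [ih]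

end WordEval

/-! ### Words and their sections at the first level. -/

/-- Words in the generators of `K(v)` and their inverses. -/
abbrev Word (m : ℕ) : Type := List (Fin (m + 1) × Bool)

/-- The section of a word at the letter `b` of the first level. -/
def sec {m : ℕ} (v : Fin m → Bool) : Word m → Bool → Word m
  | [], _ => []
  | (i, s) :: w, b =>
    Fin.cases (motive := fun _ => Word m)
      (if s = b then (Fin.last m, s) :: sec v w (!b) else sec v w (!b))
      (fun j => if b = v j then (j.castSucc, s) :: sec v w b else sec v w b) i

/-- The image of the letter `b` of the first level under a word. -/
def endState {m : ℕ} : Word m → Bool → Bool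
  | [], b => b
  | (i, _) :: w, b => endState w (if i = 0 then !b else b)

section Sections

variable {m : ℕ} (v : Fin m → Bool)

@[simp] theorem sec_nil (b : Bool) : sec v [] b = [] := rfl

theorem sec_zero (s : Bool) (w : Word m) (b : Bool) :
    sec v ((0, s) :: w) b =
      if s = b then (Fin.last m, s) :: sec v w (!b) else sec v w (!b) := rfl

theorem sec_succ (j : Fin m) (s : Bool) (w : Word m) (b : Bool) :
    sec v ((j.succ, s) :: w) b =
      if b = v j then (j.castSucc, s) :: sec v w b else sec v w b := rfl

@[simp] theorem endState_nil (b : Bool) : endState ([] : Word m) b = b := rfl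

@[simp] theorem endState_zero (s : Bool) (w : Word m) (b : Bool) :
    endState ((0, s) :: w) b = endState w (!b) := rfl

@[simp] theorem endState_succ (j : Fin m) (s : Bool) (w : Word m) (b : Bool) :
    endState ((j.succ, s) :: w) b = endState w b := by
  simp [endState]

theorem endState_not (w : Word m) : ∀ b, endState w (!b) = !endState w b := by
  induction w with
  | nil => simp
  | cons x w ih =>
    rcases x with ⟨i, s⟩
    intro b
    by_cases h : i = 0 <;> simp [endState, h, ih]

theorem app_mul (g h : TreeAut) (u : List Bool) :
    TreeAut.app u (g * h) = TreeAut.app (TreeAut.app u g) h := rfl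

@[simp] theorem app_one (u : List Bool) : TreeAut.app u 1 = u := rfl

theorem app_ext {g h : TreeAut} (H : ∀ u, TreeAut.app u g = TreeAut.app u h) : g = h := by
  apply MulOpposite.unop_injective
  exact RelIso.ext H

theorem app_inv_eq {g : TreeAut} {u w : List Bool} (h : TreeAut.app w g = u) :
    TreeAut.app u g⁻¹ = w := by
  rw [← h, ← app_mul, mul_inv_cancel, app_one]

theorem app_nil' (g : TreeAut) : TreeAut.app [] g = [] := by
  by_contra h
  obtain ⟨p, x, hp⟩ : ∃ p x, TreeAut.app [] g = p ++ [x] :=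
    ⟨_, _, (List.dropLast_append_getLast h).symm⟩
  have h1 : Child p (TreeAut.app [] g) := ⟨x, hp⟩
  have h2 : Child (TreeAut.app p g⁻¹) (TreeAut.app (TreeAut.app [] g) g⁻¹) :=
    (RelIso.map_rel_iff (g⁻¹).unop).2 h1
  rw [← app_mul, mul_inv_cancel, app_one] at h2
  obtain ⟨y, hy⟩ := h2
  simp at hy

theorem app_cons_wordEval (w : Word m) : ∀ (b : Bool) (u : List Bool),
    TreeAut.app (b :: u) (wordEval (aut v) w) =
      endState w b :: TreeAut.app u (wordEval (aut v) (sec v w b)) := by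
  induction w with
  | nil => simp
  | cons x w ih =>
    rcases x with ⟨i, s⟩
    intro b u
    rw [wordEval_cons, app_mul]
    refine Fin.cases ?_ (fun j => ?_) i
    · cases s <;> cases b <;> simp only [cond_false, cond_true]
      · rw [app_inv_eq (w := true :: TreeAut.app u (aut v (Fin.last m))⁻¹), ih]
        · simp [sec_zero, app_mul]
        · rw [app_aut_zero_true, ← app_mul, inv_mul_cancel, app_one]
      · rw [app_inv_eq (app_aut_zero_false v u), ih]
        simp [sec_zero]
      · rw [app_aut_zero_false, ih]
        simp [sec_zero]
      · rw [app_aut_zero_true, ih]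
        simp [sec_zero, app_mul]
    · by_cases h : b = v j
      · subst h
        cases s <;> simp only [cond_false, cond_true]
        · rw [app_inv_eq (w := v j :: TreeAut.app u (aut v j.castSucc)⁻¹), ih]
          · simp [sec_succ, app_mul]
          · rw [app_aut_succ_eq, ← app_mul, inv_mul_cancel, app_one]
        · rw [app_aut_succ_eq, ih]
          simp [sec_succ, app_mul]
      · cases s <;> simp only [cond_false, cond_true]
        · rw [app_inv_eq (app_aut_succ_ne v u j h), ih]
          simp [sec_succ, h]
        · rw [app_aut_succ_ne v u j h, ih]
          simp [sec_succ, h]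

theorem endState_of_trivial {w : Word m} (h : wordEval (aut v) w = 1) (b : Bool) :
    endState w b = b := by
  have := app_cons_wordEval v w b []
  rw [h, app_one] at this
  exact (List.cons.inj this).1.symm

theorem sec_trivial {w : Word m} (h : wordEval (aut v) w = 1) (b : Bool) :
    wordEval (aut v) (sec v w b) = 1 := by
  apply app_ext
  intro u
  have := app_cons_wordEval v w b u
  rw [h, app_one] at this
  exact (List.cons.inj this).2.symm

/-- Every letter passes to exactly one of the two sections, so sections never lengthen a word in
total. -/
theorem length_sec (w : Word m) : ∀ b,
    (sec v w b).length + (sec v w (!b)).length = w.length := by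
  induction w with
  | nil => simp
  | cons x w ih =>
    rcases x with ⟨i, s⟩
    intro b
    refine Fin.cases ?_ (fun j => ?_) i
    · have := ih b
      cases s <;> cases b <;> simp [sec_zero] at this ⊢ <;> omega
    · have := ih b
      cases hv : v j <;> cases b <;> simp [sec_succ, hv] at this ⊢ <;> omega

theorem length_sec_le (w : Word m) (b : Bool) : (sec v w b).length ≤ w.length := by
  have := length_sec v w b
  omega

/-! ### Words that do not shrink, and induction over trivial words. -/

/-- Every letter of the word contributes to its section at `b`, when the letter `k` is the one
that moves the first level. -/
def Full (k : Fin (m + 1)) : Word m → Bool → Prop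
  | [], _ => True
  | (i, s) :: w, b =>
    Fin.cases (motive := fun _ => Prop) (s = b ∧ Full k w (!b))
      (fun j => b = v j ∧ Full k w b) (i - k)

theorem full_self {k : Fin (m + 1)} {s : Bool} {w : Word m} {b : Bool} :
    Full v k ((k, s) :: w) b ↔ s = b ∧ Full v k w (!b) := by
  simp [Full]

/-- The state `c` in which a non-moving letter survives depends only on `i` and `k`, so two
occurrences of `i` must be met in the same state. -/
theorem full_ne {k i : Fin (m + 1)} (h : i ≠ k) :
    ∃ c : Bool, ∀ (s : Bool) (w : Word m) (b : Bool),
      Full v k ((i, s) :: w) b ↔ b = c ∧ Full v k w b := by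
  obtain ⟨j, hj⟩ := Fin.exists_succ_eq.2 (sub_ne_zero.2 h)
  exact ⟨v j, fun s w b => by simp [Full, ← hj]⟩

theorem exists_full_tail {k : Fin (m + 1)} {x : Fin (m + 1) × Bool} {w : Word m}
    (h : ∃ b, Full v k (x :: w) b) : ∃ b, Full v k w b := by
  obtain ⟨b, h⟩ := h
  rcases x with ⟨i, s⟩
  by_cases hi : i = k
  · subst hi
    exact ⟨_, ((full_self v).1 h).2⟩
  · obtain ⟨c, hc⟩ := full_ne v hi
    exact ⟨_, ((hc _ _ _).1 h).2⟩

theorem full_of_notMem {k : Fin (m + 1)} {u w : Word m} {b : Bool}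
    (hu : k ∉ u.map Prod.fst) (h : Full v k (u ++ w) b) : Full v k w b := by
  induction u with
  | nil => exact h
  | cons x u ih =>
    rcases x with ⟨i, s⟩
    simp only [List.map_cons, List.mem_cons, not_or] at hu
    obtain ⟨c, hc⟩ := full_ne v (Ne.symm hu.1)
    exact ih hu.2 ((hc _ _ _).1 h).2

/-- A word has no two adjacent mutually inverse letters. -/
def NoCancel (w : Word m) : Prop := ∀ u i s r, w ≠ u ++ (i, s) :: (i, !s) :: r

theorem NoCancel.tail {x : Fin (m + 1) × Bool} {w : Word m} (h : NoCancel (x :: w)) :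
    NoCancel w := fun u i s r e => h (x :: u) i s r (by simp [e])

/-- Suppose the first letter k recurs. If it recurs at once, `Full` at k forces opposite signs, a
cancelling pair. Otherwise let i be the letter after it: i occurs only once in the tail, and taking
i as the moving letter, the state flips exactly once between the two occurrences of k, which need
the same state. -/
theorem nodup_of_full {w : Word m} (hr : NoCancel w) (hf : ∀ k, ∃ b, Full v k w b) :
    (w.map Prod.fst).Nodup := by
  induction w with
  | nil => simp
  | cons y w ih =>
    have hw := ih hr.tail fun k => exists_full_tail v (hf k)
    rw [List.map_cons, List.nodup_cons]
    refine ⟨fun hk => ?_, hw⟩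
    rcases y with ⟨k, s⟩
    obtain ⟨⟨k', d⟩, hmem, hk'⟩ := List.mem_map.1 hk
    obtain rfl : k' = k := hk'
    obtain ⟨u, r, rfl⟩ := List.append_of_mem hmem
    cases u with
    | nil =>
      obtain ⟨b, hb⟩ := hf k'
      rw [List.nil_append, full_self, full_self] at hb
      obtain ⟨rfl, rfl, -⟩ := hb
      exact hr [] k' s r rfl
    | cons z u =>
      rcases z with ⟨i, c⟩
      simp only [List.cons_append, List.map_cons, List.map_append, List.nodup_cons,
        List.mem_append, List.mem_cons, not_or] at hw
      obtain ⟨⟨hiu, hik, -⟩, -⟩ := hw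
      obtain ⟨b, hb⟩ := hf i
      obtain ⟨q, hq⟩ := full_ne v (Ne.symm hik)
      rw [hq, List.cons_append, full_self] at hb
      have := (hq _ _ _).1 (full_of_notMem v hiu hb.2.2)
      obtain ⟨rfl, -⟩ := hb
      simp at this

/-- The word obtained by lowering all indices by `k`. -/
def shift (k : Fin (m + 1)) (w : Word m) : Word m := w.map fun x => (x.1 - k, x.2)

theorem full_zero_shift {k : Fin (m + 1)} {w : Word m} : ∀ {b},
    Full v 0 (shift k w) b ↔ Full v k w b := by
  induction w with
  | nil => simp [shift, Full]
  | cons x w ih =>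
    rcases x with ⟨i, s⟩
    intro b
    by_cases hi : i = k
    · subst hi
      have := full_self v (k := 0) (s := s) (w := shift i w) (b := b)
      simp only [shift, List.map_cons, sub_self] at this ⊢
      rw [this, full_self]
      exact and_congr_right fun _ => ih
    · obtain ⟨j, hj⟩ := Fin.exists_succ_eq.2 (sub_ne_zero.2 hi)
      change Full v 0 ((i - k, s) :: shift k w) b ↔ _
      simp [Full, ← hj, ih]

theorem neg_one_eq_last : (-1 : Fin (m + 1)) = Fin.last m := by
  rw [neg_eq_iff_add_eq_zero]
  exact (add_comm _ _).trans (Fin.last_add_one m)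

theorem succ_sub_one (j : Fin m) : j.succ - 1 = j.castSucc := by
  rw [sub_eq_iff_eq_add, Fin.coeSucc_eq_succ]

/-- A surviving letter has its index lowered by one modulo n, since a₁ leaves a_n; a section of full
length is therefore a cyclic relabelling of the word. -/
theorem sec_of_length_eq {w : Word m} : ∀ {b}, (sec v w b).length = w.length →
    sec v w b = shift 1 w ∧ Full v 0 w b := by
  induction w with
  | nil => simp [shift, Full]
  | cons x w ih =>
    rcases x with ⟨i, s⟩
    intro b
    refine Fin.cases ?_ (fun j => ?_) i
    · rw [sec_zero, full_self]
      split_ifs with h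
      · simp only [List.length_cons, Nat.add_right_cancel_iff]
        intro hl
        obtain ⟨h1, h2⟩ := ih hl
        simp [h1, h2, h, shift, neg_one_eq_last]
      · have := length_sec_le v w (!b)
        simp only [List.length_cons]
        omega
    · rw [sec_succ]
      split_ifs with h
      · simp only [List.length_cons, Nat.add_right_cancel_iff]
        intro hl
        obtain ⟨h1, h2⟩ := ih hl
        simp [h1, h2, ← h, shift, succ_sub_one, Full]
      · have := length_sec_le v w b
        simp only [List.length_cons]
        omega

theorem endState_eq_iff (w : Word m) (b : Bool) :
    endState w b = b ↔ Even ((w.map Prod.fst).count 0) := by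
  induction w generalizing b with
  | nil => simp
  | cons x w ih =>
    rcases x with ⟨i, s⟩
    refine Fin.cases ?_ (fun j => ?_) i
    · rw [endState_zero, endState_not, List.map_cons, List.count_cons_self, Nat.even_add_one,
        ← ih b]
      cases b <;> cases endState w _ <;> simp
    · rw [endState_succ, List.map_cons, List.count_cons_of_ne (Fin.succ_ne_zero j), ih]

theorem shift_shift (k l : Fin (m + 1)) (w : Word m) : shift k (shift l w) = shift (l + k) w := by
  simp [shift, sub_sub]

theorem count_shift (k : Fin (m + 1)) (w : Word m) :
    ((shift k w).map Prod.fst).count 0 = (w.map Prod.fst).count k := by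
  have : (shift k w).map Prod.fst = (w.map Prod.fst).map (· - k) := by simp [shift]
  rw [this, ← sub_self k, List.count_map_of_injective _ _ (sub_left_injective)]

/-- Induction over the words that are trivial in `K(v)`. -/
theorem trivial_word_induction (P : Word m → Prop) (nil : P [])
    (cancel : ∀ u i s r, P (u ++ r) → P (u ++ (i, s) :: (i, !s) :: r))
    (split : ∀ w, wordEval (aut v) w = 1 → P (sec v w false) → P (sec v w true) → P w)
    (w : Word m) (hw : wordEval (aut v) w = 1) : P w := by
  induction hn : w.length using Nat.strong_induction_on generalizing w with
  | _ n ih =>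
  by_contra hP
  -- A counterexample of minimal length has a section that is also a counterexample, hence of full
  -- length; iterating reaches every shift of `w`.
  have step : ∀ u : Word m, wordEval (aut v) u = 1 → ¬ P u → u.length = n →
      wordEval (aut v) (shift 1 u) = 1 ∧ ¬ P (shift 1 u) ∧ ∃ b, Full v 0 u b := by
    intro u hu hPu hl
    have key : ∃ b, (sec v u b).length = u.length ∧ ¬ P (sec v u b) := by
      have hb : ∃ b, ¬ P (sec v u b) := by
        by_contra! h
        exact hPu (split u hu (h _) (h _))
      obtain ⟨b, hb⟩ := hb
      refine ⟨b, ?_, hb⟩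
      by_contra hne
      refine hb (ih _ ?_ _ (sec_trivial v hu b) rfl)
      have := length_sec_le v u b
      omega
    obtain ⟨b, h1, h2⟩ := key
    obtain ⟨h3, h4⟩ := sec_of_length_eq v h1
    rw [← h3]
    exact ⟨sec_trivial v hu b, h2, b, h4⟩
  have all : ∀ k, wordEval (aut v) (shift k w) = 1 ∧ ¬ P (shift k w) := by
    intro k
    induction k using Fin.induction with
    | zero => simpa [shift] using And.intro hw hP
    | succ k ihk =>
      have := step _ ihk.1 ihk.2 (by simpa [shift] using hn)
      rw [shift_shift, Fin.coeSucc_eq_succ] at this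
      exact ⟨this.1, this.2.1⟩
  have hfull : ∀ k, ∃ b, Full v k w b := by
    intro k
    obtain ⟨-, -, b, hb⟩ := step _ (all k).1 (all k).2 (by simpa [shift] using hn)
    exact ⟨b, (full_zero_shift v).1 hb⟩
  -- The shift by k is trivial, so it fixes the first level, and its letters of index 0 come from
  -- those of index k in `w`.
  have heven : ∀ k, Even ((w.map Prod.fst).count k) := by
    intro k
    rw [← count_shift, ← endState_eq_iff _ true]
    exact endState_of_trivial v (all k).1 true
  have hred : NoCancel w := by
    rintro u i s r rfl
    refine hP (cancel u i s r (ih _ ?_ _ ?_ rfl))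
    · simp [← hn]
    · rwa [wordEval_cancel] at hw
  have hnd := nodup_of_full v hred hfull
  apply hP
  rcases w with _ | ⟨x, w⟩
  · exact nil
  · have h1 := heven x.1
    rw [List.count_eq_one_of_mem hnd (by simp)] at h1
    simp at h1

end Sections


/-! ### Exponent sums vanish on trivial words. -/

/-- The exponent sum of the letter `i` in a word. -/
def expSum {ι : Type*} [DecidableEq ι] (i : ι) (w : List (ι × Bool)) : ℤ :=
  (w.map fun x => if x.1 = i then cond x.2 1 (-1) else 0).sum

section ExpSum

variable {m : ℕ} (v : Fin m → Bool)

@[simp] theorem expSum_nil {ι : Type*} [DecidableEq ι] (i : ι) : expSum i [] = 0 := rfl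

@[simp] theorem expSum_cons {ι : Type*} [DecidableEq ι] (i j : ι) (s : Bool)
    (w : List (ι × Bool)) :
    expSum i ((j, s) :: w) = (if j = i then cond s 1 (-1) else 0) + expSum i w := by
  simp [expSum]

theorem expSum_append {ι : Type*} [DecidableEq ι] (i : ι) (u w : List (ι × Bool)) :
    expSum i (u ++ w) = expSum i u + expSum i w := by
  simp [expSum]

theorem expSum_last_sec (w : Word m) : ∀ b,
    expSum (Fin.last m) (sec v w b) + expSum (Fin.last m) (sec v w (!b)) = expSum 0 w := by
  induction w with
  | nil => simp
  | cons x w ih =>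
    rcases x with ⟨i, s⟩
    intro b
    refine Fin.cases ?_ (fun j => ?_) i
    · have := ih b
      cases s <;> cases b <;> simp [sec_zero] at this ⊢ <;> omega
    · have := ih b
      have h1 := (Fin.castSucc_lt_last j).ne
      have h2 := Fin.succ_ne_zero j
      cases hv : v j <;> cases b <;> simp [sec_succ, hv, h1, h2] at this ⊢ <;> omega

theorem expSum_castSucc_sec (k : Fin m) (w : Word m) : ∀ b,
    expSum k.castSucc (sec v w b) + expSum k.castSucc (sec v w (!b)) = expSum k.succ w := by
  induction w with
  | nil => simp
  | cons x w ih =>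
    rcases x with ⟨i, s⟩
    intro b
    refine Fin.cases ?_ (fun j => ?_) i
    · have := ih b
      have h1 := (Fin.castSucc_lt_last k).ne'
      have h2 := (Fin.succ_ne_zero k).symm
      cases s <;> cases b <;> simp [sec_zero, h1, h2] at this ⊢ <;> omega
    · have := ih b
      by_cases hk : j = k
      · subst hk
        cases hv : v j <;> cases b <;> simp [sec_succ, hv] at this ⊢ <;> omega
      · cases hv : v j <;> cases b <;> simp [sec_succ, hv, hk] at this ⊢ <;> omega

theorem expSum_eq_zero {w : Word m} (hw : wordEval (aut v) w = 1) (i : Fin (m + 1)) :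
    expSum i w = 0 := by
  revert i
  refine trivial_word_induction v (fun w => ∀ i, expSum i w = 0) (by simp) ?_ ?_ w hw
  · intro u i s r h k
    rw [← h k, expSum_append, expSum_append, expSum_cons, expSum_cons]
    cases s <;> by_cases hik : i = k <;> simp [hik]
  · intro w _ h0 h1 i
    refine Fin.cases ?_ (fun j => ?_) i
    · rw [← expSum_last_sec v w false, h0, Bool.not_false, h1, add_zero]
    · rw [← expSum_castSucc_sec v j w false, h0, Bool.not_false, h1, add_zero]

end ExpSum

/-! ### Homomorphisms out of K(v). -/

section Lift

variable {m : ℕ} (v : Fin m → Bool)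

theorem coe_wordEval_gen (w : Word m) :
    (wordEval (gen v) w : K v).1 = wordEval (aut v) w :=
  map_wordEval (gen v) (K v).subtype w

theorem lift_gen_surjective : Function.Surjective (FreeGroup.lift (gen v)) := by
  rw [← MonoidHom.range_eq_top, FreeGroup.range_lift_eq_closure, eq_top_iff]
  refine (Subgroup.closure_closure_coe_preimage (k := Set.range (aut v))).ge.trans
    ((Subgroup.closure_le _).2 ?_)
  rintro ⟨_, hx⟩ ⟨i, rfl⟩
  exact Subgroup.subset_closure ⟨i, rfl⟩

theorem exists_wordEval_gen (g : K v) : ∃ w, wordEval (gen v) w = g := by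
  obtain ⟨x, rfl⟩ := lift_gen_surjective v g
  exact ⟨x.toWord, by rw [← lift_mk_eq_wordEval, FreeGroup.mk_toWord]⟩

theorem exists_hom_of_trivial {G : Type*} [Group G] (f : Fin (m + 1) → G)
    (hf : ∀ w, wordEval (aut v) w = 1 → wordEval f w = 1) :
    ∃ F : K v →* G, ∀ i, F (gen v i) = f i := by
  have hker : (FreeGroup.lift (gen v)).ker ≤ (FreeGroup.lift f).ker := by
    intro x hx
    rw [MonoidHom.mem_ker, ← FreeGroup.mk_toWord (x := x), lift_mk_eq_wordEval] at hx ⊢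
    apply hf
    rw [← coe_wordEval_gen, hx, Subgroup.coe_one]
  refine ⟨MonoidHom.liftOfSurjective _ (lift_gen_surjective v) ⟨FreeGroup.lift f, hker⟩,
    fun i => ?_⟩
  have := MonoidHom.liftOfRightInverse_comp_apply (FreeGroup.lift (gen v)) _
    (Function.rightInverse_surjInv (lift_gen_surjective v)) ⟨FreeGroup.lift f, hker⟩
    (FreeGroup.of i)
  simpa using this

theorem hom_ext_gen {G : Type*} [Group G] {F F' : K v →* G}
    (h : ∀ i, F (gen v i) = F' (gen v i)) : F = F' := by
  ext g
  obtain ⟨w, rfl⟩ := exists_wordEval_gen v g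
  simp [map_wordEval, h]

end Lift

/-! ### Diagonal automorphisms and the endomorphism φ. -/

/-- The automorphism `g` is `⟨h, k⟩`. -/
def Diag (g h k : TreeAut) : Prop :=
  ∀ u, TreeAut.app (false :: u) g = false :: TreeAut.app u h ∧
    TreeAut.app (true :: u) g = true :: TreeAut.app u k

namespace Diag

theorem one : Diag 1 1 1 := fun u => by simp

theorem mul {g h k g' h' k' : TreeAut} (H : Diag g h k) (H' : Diag g' h' k') :
    Diag (g * g') (h * h') (k * k') := fun u => by
  simp [app_mul, (H u).1, (H u).2, (H' _).1, (H' _).2]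

theorem inv {g h k : TreeAut} (H : Diag g h k) : Diag g⁻¹ h⁻¹ k⁻¹ := fun u => by
  constructor
  · apply app_inv_eq
    rw [(H _).1, ← app_mul, inv_mul_cancel, app_one]
  · apply app_inv_eq
    rw [(H _).2, ← app_mul, inv_mul_cancel, app_one]

theorem ext {g g' h k : TreeAut} (H : Diag g h k) (H' : Diag g' h k) : g = g' := by
  apply app_ext
  rintro (_ | ⟨_ | _, u⟩)
  · rw [app_nil', app_nil']
  · rw [(H u).1, (H' u).1]
  · rw [(H u).2, (H' u).2]

theorem left_eq_one {h k : TreeAut} (H : Diag 1 h k) : h = 1 := by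
  apply app_ext
  intro u
  simpa using (H u).1.symm

theorem conj_one {g h k g' h' : TreeAut} (H : Diag g h k) (H' : Diag g' h' 1) :
    Diag (g⁻¹ * g' * g) (h⁻¹ * h' * h) 1 := by
  simpa using (H.inv.mul H').mul H

end Diag

section Endomorphism

variable {m : ℕ} (v : Fin m → Bool)

/-- The images of the generators under the endomorphism `φ`. -/
def phiGen (i : Fin (m + 1)) : K v :=
  Fin.lastCases (motive := fun _ => K v) (gen v 0 ^ 2)
    (fun j => if v j = false then gen v j.succ
      else gen v 0 * gen v j.succ * (gen v 0)⁻¹) i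

theorem phiGen_last : phiGen v (Fin.last m) = gen v 0 ^ 2 := by simp [phiGen]

theorem phiGen_castSucc (j : Fin m) : phiGen v j.castSucc =
    if v j = false then gen v j.succ else gen v 0 * gen v j.succ * (gen v 0)⁻¹ := by
  simp [phiGen]

theorem diag_phiGen_last :
    Diag (phiGen v (Fin.last m)) (aut v (Fin.last m)) (aut v (Fin.last m)) := by
  rw [phiGen_last]
  intro u
  change TreeAut.app _ (aut v 0 ^ 2) = _ ∧ TreeAut.app _ (aut v 0 ^ 2) = _
  simp [pow_two, app_mul, app_aut_zero_false, app_aut_zero_true]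

theorem diag_phiGen_castSucc (j : Fin m) :
    Diag (phiGen v j.castSucc) (aut v j.castSucc) 1 := by
  rw [phiGen_castSucc]
  intro u
  split_ifs with h
  · change TreeAut.app _ (aut v j.succ) = _ ∧ TreeAut.app _ (aut v j.succ) = _
    have h1 := app_aut_succ_eq v u j
    rw [h] at h1
    rw [h1, app_aut_succ_ne v u j (b := true) (by simp [h])]
    simp
  · rw [Bool.not_eq_false] at h
    change TreeAut.app _ (aut v 0 * aut v j.succ * (aut v 0)⁻¹) = _ ∧
      TreeAut.app _ (aut v 0 * aut v j.succ * (aut v 0)⁻¹) = _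
    have h1 := fun u => app_aut_succ_eq v u j
    rw [h] at h1
    simp only [app_mul, app_aut_zero_false, app_aut_zero_true, h1,
      app_aut_succ_ne v _ j (b := false) (by simp [h])]
    exact ⟨app_inv_eq (app_aut_zero_false v _), app_inv_eq (app_aut_zero_true v _)⟩

theorem diag_phiGen (i : Fin (m + 1)) :
    Diag (phiGen v i) (aut v i) (aut v (Fin.last m) ^ (if i = Fin.last m then 1 else 0 : ℤ)) := by
  refine Fin.lastCases ?_ (fun j => ?_) i
  · simpa using diag_phiGen_last v
  · simpa [(Fin.castSucc_lt_last j).ne] using diag_phiGen_castSucc v j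

/-- Among the images of the generators only a₁² = ⟨a_n, a_n⟩ has a nontrivial right coordinate, so
the right coordinate only counts occurrences of a_n. -/
theorem diag_wordEval_phiGen (w : Word m) :
    Diag (wordEval (phiGen v) w : K v) (wordEval (aut v) w)
      (aut v (Fin.last m) ^ expSum (Fin.last m) w) := by
  induction w with
  | nil => exact Diag.one
  | cons x w ih =>
    rcases x with ⟨i, s⟩
    rw [wordEval_cons, wordEval_cons, expSum_cons, zpow_add]
    refine Diag.mul ?_ ih
    cases s
    · have := (diag_phiGen v i).inv
      by_cases h : i = Fin.last m <;> simpa [h] using this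
    · have := diag_phiGen v i
      by_cases h : i = Fin.last m <;> simpa [h] using this

theorem exists_phi : ∃ φ : K v →* K v, ∀ i, φ (gen v i) = phiGen v i := by
  refine exists_hom_of_trivial v _ fun w hw => ?_
  have := diag_wordEval_phiGen v w
  rw [hw, expSum_eq_zero v hw, zpow_zero] at this
  exact Subtype.ext (this.ext Diag.one)

variable {v} {φ : K v →* K v}

theorem diag_phi (hφ : ∀ i, φ (gen v i) = phiGen v i) (g : K v) : ∃ k, Diag (φ g) g k := by
  obtain ⟨w, rfl⟩ := exists_wordEval_gen v g
  have := diag_wordEval_phiGen v w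
  rw [coe_wordEval_gen, map_wordEval]
  simp only [hφ]
  exact ⟨_, this⟩

theorem phi_injective (hφ : ∀ i, φ (gen v i) = phiGen v i) : Function.Injective φ := by
  rw [injective_iff_map_eq_one]
  intro g hg
  obtain ⟨k, hk⟩ := diag_phi hφ g
  rw [hg] at hk
  exact Subtype.ext hk.left_eq_one

end Endomorphism


/-! ### Conjugation and commutator identities. -/

section Conj

variable {G : Type*} [Group G]

theorem conj_eq (g h : G) : conj g h = MulAut.conj h⁻¹ g := by simp [conj]

theorem conj_mul (g g' h : G) : conj (g * g') h = conj g h * conj g' h := by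
  simp [conj, mul_assoc]

theorem conj_inv (g h : G) : conj g⁻¹ h = (conj g h)⁻¹ := by
  simp [conj, mul_assoc]

theorem conj_zpow (g h : G) (k : ℤ) : conj (g ^ k) h = conj g h ^ k := by
  simp only [conj_eq, map_zpow]

theorem conj_conj (g h k : G) : conj (conj g h) k = conj g (h * k) := by
  simp [conj, mul_assoc]

@[simp] theorem conj_one_left (h : G) : conj 1 h = 1 := by simp [conj]

@[simp] theorem conj_one_right (g : G) : conj g 1 = g := by simp [conj]

theorem commute_conj_iff {g g' h : G} : Commute (conj g h) (conj g' h) ↔ Commute g g' := by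
  simp only [conj_eq]
  exact commute_map_iff (MulAut.conj h⁻¹).injective

theorem comm_eq_one_iff {g h : G} : comm g h = 1 ↔ Commute g h := by
  rw [comm, commute_iff_eq, mul_assoc, mul_assoc, inv_mul_eq_one, eq_inv_mul_iff_mul_eq, eq_comm]

theorem map_conj {G' : Type*} [Group G'] (F : G →* G') (g h : G) :
    F (conj g h) = conj (F g) (F h) := by simp [conj]

theorem map_comm {G' : Type*} [Group G'] (F : G →* G') (g h : G) :
    F (comm g h) = comm (F g) (F h) := by simp [comm]

theorem map_powP {G' : Type*} [Group G'] (F : G →* G') {m : ℕ} (v : Fin m → Bool) (a t : G) :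
    F (powP v a t) = powP v (F a) (F t) := by
  simp only [powP, map_list_prod, List.map_ofFn, Function.comp_def, map_conj, map_zpow, map_pow]

theorem commute_conj_of_closure {S : Set G} {h : G}
    (H : ∀ x ∈ S, ∀ y ∈ S, Commute x (conj y h)) :
    ∀ x ∈ Subgroup.closure S, ∀ y ∈ Subgroup.closure S, Commute x (conj y h) := by
  intro x hx y hy
  induction hy using Subgroup.closure_induction with
  | mem y hy =>
    induction hx using Subgroup.closure_induction with
    | mem x hx => exact H x hx y hy
    | one => exact Commute.one_left _
    | mul x x' _ _ h1 h2 => exact h1.mul_left h2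
    | inv x _ h1 => exact h1.inv_left
  | one => simp
  | mul y y' _ _ h1 h2 => rw [conj_mul]; exact h1.mul_right h2
  | inv y _ h1 => rw [conj_inv]; exact h1.inv_right

/-- Since z⁻¹ z^s = (s⁻¹)^z s is a product of commuting factors, its l-th power is z⁻¹ z^{s^l}. Thus
all the conjugates z^{s^l} are generated by z and z^s. -/
theorem conj_zpow_right {s z : G} (h : Commute s (conj s z)) (l : ℤ) :
    conj z (s ^ l) = z * (z⁻¹ * conj z s) ^ l := by
  have e : z⁻¹ * conj z s = (conj s z)⁻¹ * s := by simp [conj, mul_assoc]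
  rw [e, (h.symm.inv_left).mul_zpow, ← conj_inv, ← conj_zpow]
  simp [conj, mul_assoc]

end Conj

/-! ### The relators and the recursion of the generators. -/

/-- The relators of `Γ` hold for the pair `a, t`. -/
structure RelsHold {G : Type*} [Group G] {m : ℕ} (v : Fin m → Bool) (a t : G) : Prop where
  pow : conj a (t ^ (m + 1)) * conj (a ^ (-2 : ℤ)) (powP v a t) = 1
  comm_one : ∀ i j, 1 ≤ i → i < m + 1 → 1 ≤ j → j < m + 1 →
    Commute (conj a (t ^ i)) (conj a (t ^ j * a))
  comm_three : ∀ i j, 1 ≤ i → i < m + 1 → 1 ≤ j → j < m + 1 →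
    Commute (conj a (t ^ i)) (conj a (t ^ j * a ^ 3))

theorem relsHold_iff {G : Type*} [Group G] {m : ℕ} (v : Fin m → Bool) (F : FreeGroup Letter →* G) :
    RelsHold v (F (FreeGroup.of Letter.a)) (F (FreeGroup.of Letter.t)) ↔
      ∀ r ∈ rels v, F r = 1 := by
  constructor
  · rintro h r ((rfl | ⟨i, j, h1, h2, h3, h4, rfl⟩) | ⟨i, j, h1, h2, h3, h4, rfl⟩)
    · simpa [map_conj, map_powP] using h.pow
    · simpa [map_comm, map_conj, comm_eq_one_iff] using h.comm_one i j h1 h2 h3 h4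
    · simpa [map_comm, map_conj, comm_eq_one_iff] using h.comm_three i j h1 h2 h3 h4
  · intro h
    refine ⟨?_, fun i j h1 h2 h3 h4 => ?_, fun i j h1 h2 h3 h4 => ?_⟩
    · have := h _ (Or.inl (Or.inl rfl))
      simpa [map_conj, map_powP] using this
    · have := h _ (Or.inl (Or.inr ⟨i, j, h1, h2, h3, h4, rfl⟩))
      simpa [map_comm, map_conj, comm_eq_one_iff] using this
    · have := h _ (Or.inr ⟨i, j, h1, h2, h3, h4, rfl⟩)
      simpa [map_comm, map_conj, comm_eq_one_iff] using this

theorem relsHold_gam {m : ℕ} (v : Fin m → Bool) : RelsHold v (ga v) (gt v) :=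
  (relsHold_iff v (PresentedGroup.mk (rels v))).2 fun _ hr => PresentedGroup.one_of_mem hr

/-- The letters `x_{k+1}` as exponents, extended by zero. -/
def letterExp {m : ℕ} (v : Fin m → Bool) (k : ℕ) : ℤ :=
  if h : k < m then if v ⟨k, h⟩ = true then 1 else 0 else 0

/-- The product `a ^ x_k * τ (a ^ x_{k-1}) * ⋯ * τ ^ (k-1) (a ^ x_1)`. -/
def twist {G : Type*} [Group G] (τ : G →* G) (a : G) (x : ℕ → ℤ) : ℕ → G
  | 0 => 1
  | k + 1 => a ^ x k * τ (twist τ a x k)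

/-- Conjugation by `t` as an endomorphism. -/
def conjHom {G : Type*} [Group G] (t : G) : G →* G := (MulAut.conj t⁻¹).toMonoidHom

section Twist

variable {G : Type*} [Group G] {m : ℕ} (v : Fin m → Bool)

@[simp] theorem conjHom_apply (t g : G) : conjHom t g = conj g t := (conj_eq g t).symm

theorem conjHom_iterate (t g : G) (k : ℕ) : (conjHom t)^[k] g = conj g (t ^ k) := by
  induction k with
  | zero => simp
  | succ k ih => rw [Function.iterate_succ_apply', ih, conjHom_apply, conj_conj, pow_succ]

/-- The family `c` obeys the recursion of the generators `a_i`, with `τ` in place of `φ` and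
`a⁻¹` in place of `a₁`. -/
structure IsGenFamily (τ : G →* G) (a : G) (c : Fin (m + 1) → G) : Prop where
  zero : c 0 = a⁻¹
  succ : ∀ j : Fin m, c j.succ = a ^ letterExp v j * τ (c j.castSucc) * (a ^ letterExp v j)⁻¹

theorem letterExp_of_false {j : Fin m} (h : v j = false) : letterExp v j = 0 := by
  simp [letterExp, h]

theorem letterExp_of_true {j : Fin m} (h : v j = true) : letterExp v j = 1 := by
  simp [letterExp, h]

variable {v} {τ : G →* G} {a t : G} {c : Fin (m + 1) → G}

/-- Unrolling the recursion collects the conjugators a^{x_j} into a single one; its last instance,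
conjugated by t, is a^{p(t)}. -/
theorem IsGenFamily.eq_twist (h : IsGenFamily v τ a c) (i : Fin (m + 1)) :
    c i = twist τ a (letterExp v) i * (τ^[i] a)⁻¹ * (twist τ a (letterExp v) i)⁻¹ := by
  induction i using Fin.induction with
  | zero => simp [twist, h.zero]
  | succ j ih =>
    rw [h.succ, ih, Fin.val_succ, twist, Function.iterate_succ_apply']
    simp [mul_assoc]

theorem conj_twist (x : ℕ → ℤ) (k : ℕ) : conj (twist (conjHom t) a x k) t =
    (List.ofFn fun j : Fin k => conj (a ^ x (k - 1 - j)) (t ^ (j.val + 1))).prod := by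
  induction k with
  | zero => simp [twist]
  | succ k ih =>
    rw [twist, conj_mul, conjHom_apply, ih, List.ofFn_succ, List.prod_cons, ← conjHom_apply t
      (List.prod _), map_list_prod, List.map_ofFn]
    congr 1
    · simp
    · congr 2
      ext j
      simp only [Function.comp, conjHom_apply, conj_conj, Fin.val_succ, pow_succ]
      congr 3
      omega

theorem powP_eq (v : Fin m → Bool) (a t : G) :
    powP v a t = conj (twist (conjHom t) a (letterExp v) m) t := by
  rw [conj_twist, powP]
  congr 2
  ext j
  have h : m - 1 - j.val < m := by have := j.2; omega
  rw [letterExp, dif_pos h]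
  congr 4
  apply congrArg v
  ext
  simp
  omega

/-- This identifies the first relator with the relation φ(a_n) = a₁². -/
theorem IsGenFamily.conj_last_iff (h : IsGenFamily v (conjHom t) a c) :
    conj (c (Fin.last m)) t = a ^ (-2 : ℤ) ↔
      conj a (t ^ (m + 1)) * conj (a ^ (-2 : ℤ)) (powP v a t) = 1 := by
  have e : conj (c (Fin.last m)) t =
      powP v a t * (conj a (t ^ (m + 1)))⁻¹ * (powP v a t)⁻¹ := by
    rw [h.eq_twist, conj_mul, conj_mul, conj_inv (twist _ _ _ _), Fin.val_last, ← powP_eq,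
      conjHom_iterate, conj_inv, conj_conj, ← pow_succ]
  have e' : conj (a ^ (-2 : ℤ)) (powP v a t) =
      (powP v a t)⁻¹ * a ^ (-2 : ℤ) * powP v a t := rfl
  rw [e, e']
  constructor
  · intro h
    rw [← h]
    group
  · intro h
    rw [eq_inv_of_mul_eq_one_left h]
    group

end Twist


/-! ### Commutation consequences of the relators and the section formula. -/

section Relations

variable {G : Type*} [Group G] {m : ℕ} {v : Fin m → Bool} {a t : G} {c : Fin (m + 1) → G}

/-- The subgroup generated by `a^t, …, a^{t^m}`. -/
def powSubgroup (m : ℕ) (a t : G) : Subgroup G :=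
  Subgroup.closure {x | ∃ i, 1 ≤ i ∧ i < m + 1 ∧ x = conj a (t ^ i)}

theorem mem_powSubgroup {i : ℕ} (h1 : 1 ≤ i) (h2 : i < m + 1) :
    conj a (t ^ i) ∈ powSubgroup m a t :=
  Subgroup.subset_closure ⟨i, h1, h2, rfl⟩

theorem conj_twist_mem (x : ℕ → ℤ) (k : ℕ) : ∀ r, k + r ≤ m →
    conj (twist (conjHom t) a x k) (t ^ (r + 1)) ∈ powSubgroup m a t := by
  induction k with
  | zero => simp [twist, one_mem]
  | succ k ih =>
    intro r hr
    rw [twist, conj_mul, conj_zpow, conjHom_apply, conj_conj, ← pow_succ']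
    exact mul_mem (zpow_mem (mem_powSubgroup (by omega) (by omega)) _) (ih _ (by omega))

theorem powP_mem : powP v a t ∈ powSubgroup m a t := by
  rw [powP_eq]
  simpa using conj_twist_mem (t := t) (a := a) (m := m) (letterExp v) m 0 le_rfl

theorem IsGenFamily.conj_castSucc_mem (hc : IsGenFamily v (conjHom t) a c) (j : Fin m) :
    conj (c j.castSucc) t ∈ powSubgroup m a t := by
  rw [hc.eq_twist, conj_mul, conj_mul, conj_inv (twist _ _ _ _), conjHom_iterate, conj_inv,
    conj_conj, ← pow_succ]
  have h := conj_twist_mem (t := t) (a := a) (m := m) (letterExp v) j.castSucc.val 0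
    (by simp)
  rw [zero_add, pow_one] at h
  exact mul_mem (mul_mem h (inv_mem (mem_powSubgroup (by omega) (by simp)))) (inv_mem h)

namespace RelsHold

theorem commute_conj_one (hR : RelsHold v a t) : ∀ x ∈ powSubgroup m a t, ∀ y ∈ powSubgroup m a t,
    Commute x (conj y a) := by
  refine commute_conj_of_closure ?_
  rintro _ ⟨i, hi, hi', rfl⟩ _ ⟨j, hj, hj', rfl⟩
  rw [conj_conj]
  exact hR.comm_one i j hi hi' hj hj'

theorem commute_conj_three (hR : RelsHold v a t) : ∀ x ∈ powSubgroup m a t, ∀ y ∈ powSubgroup m a t,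
    Commute x (conj y (a ^ 3)) := by
  refine commute_conj_of_closure ?_
  rintro _ ⟨i, hi, hi', rfl⟩ _ ⟨j, hj, hj', rfl⟩
  rw [conj_conj]
  exact hR.comm_three i j hi hi' hj hj'

theorem conj_pow_eq (hR : RelsHold v a t) : conj a (t ^ (m + 1)) = conj (a ^ 2) (powP v a t) := by
  rw [eq_inv_of_mul_eq_one_left hR.pow, ← conj_inv, zpow_neg, inv_inv, zpow_ofNat]

/-- Conjugate the relator [a^{t^i}, a^{t^i a}] with i = n − k by t^k: it says that a^{t^n} commutes
with its conjugate by a^{t^k}. Replace a^{t^n} by (a²)^P and conjugate by P⁻¹. -/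
theorem commute_sq (hR : RelsHold v a t) {k : ℕ} (h1 : 1 ≤ k) (h2 : k < m + 1) :
    Commute (a ^ 2) (conj (a ^ 2) (powP v a t * conj a (t ^ k) * (powP v a t)⁻¹)) := by
  have h := hR.comm_one (m + 1 - k) (m + 1 - k) (by omega) (by omega) (by omega) (by omega)
  rw [← commute_conj_iff (h := t ^ k), conj_conj, conj_conj, ← pow_add,
    Nat.sub_add_cancel h2.le] at h
  have e : t ^ (m + 1 - k) * a * t ^ k = t ^ (m + 1) * conj a (t ^ k) := by
    rw [← Nat.sub_add_cancel h2.le, pow_add, Nat.sub_add_cancel h2.le]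
    simp [conj, mul_assoc]
  rw [e, ← conj_conj, hR.conj_pow_eq, conj_conj,
    ← commute_conj_iff (h := (powP v a t)⁻¹), conj_conj, conj_conj, mul_inv_cancel,
    conj_one_right] at h
  exact h

/-- The elements z = P a^{t^k} P⁻¹ generate B because P lies in B. By `commute_sq`,
`conj_zpow_right` applies with s = a² and gives z^{a^{2l+1}} = z^a ((z^a)⁻¹ z^{a³})^l, so the cases
a and a³ suffice. -/
theorem commute_conj_odd (hR : RelsHold v a t) : ∀ x ∈ powSubgroup m a t, ∀ y ∈ powSubgroup m a t, ∀ l : ℤ,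
    Commute x (conj y (a ^ (2 * l + 1))) := by
  intro x hx y hy l
  set P := powP v a t with hP
  have hPm : P ∈ powSubgroup m a t := powP_mem
  have key : ∀ y ∈ powSubgroup m a t, Commute x (conj (P * y * P⁻¹) (a ^ (2 * l + 1))) := by
    intro y hy
    induction hy using Subgroup.closure_induction with
    | mem y hy =>
      obtain ⟨k, h1, h2, rfl⟩ := hy
      set z := P * conj a (t ^ k) * P⁻¹ with hz
      have hzm : z ∈ powSubgroup m a t :=
        mul_mem (mul_mem hPm (mem_powSubgroup h1 h2)) (inv_mem hPm)
      have hsq : Commute (a ^ 2) (conj (a ^ 2) z) := hR.commute_sq h1 h2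
      clear_value z
      have e : conj z (a ^ (2 * l + 1)) =
          conj z a * ((conj z a)⁻¹ * conj z (a ^ 3)) ^ l := by
        rw [zpow_add, zpow_mul, zpow_one, ← conj_conj, zpow_ofNat,
          conj_zpow_right hsq, conj_mul, conj_zpow, conj_mul, conj_inv,
          conj_conj, ← pow_succ]
      rw [e]
      have c1 := hR.commute_conj_one x hx z hzm
      exact c1.mul_right ((c1.inv_right.mul_right
        (hR.commute_conj_three x hx z hzm)).zpow_right l)
    | one => simp
    | mul y y' _ _ h1 h2 =>
      have e : P * (y * y') * P⁻¹ = (P * y * P⁻¹) * (P * y' * P⁻¹) := by group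
      rw [e, conj_mul]
      exact h1.mul_right h2
    | inv y _ h1 =>
      have e : P * y⁻¹ * P⁻¹ = (P * y * P⁻¹)⁻¹ := by group
      rw [e, conj_inv]
      exact h1.inv_right
  have := key (P⁻¹ * y * P) (mul_mem (mul_mem (inv_mem hPm) hy) hPm)
  convert this using 2
  group

end RelsHold

/-- The normal closure of `⟨a^t, …, a^{t^m}⟩` under conjugation by `a²`. -/
def evenSubgroup (m : ℕ) (a t : G) : Subgroup G :=
  Subgroup.closure {x | ∃ y ∈ powSubgroup m a t, ∃ k : ℤ, x = conj y (a ^ (2 * k))}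

theorem mem_evenSubgroup {y : G} (hy : y ∈ powSubgroup m a t) : y ∈ evenSubgroup m a t :=
  Subgroup.subset_closure ⟨y, hy, 0, by simp⟩

theorem conj_mem_evenSubgroup {y : G} (hy : y ∈ evenSubgroup m a t) (l : ℤ) :
    conj y (a ^ (2 * l)) ∈ evenSubgroup m a t := by
  induction hy using Subgroup.closure_induction with
  | mem y hy =>
    obtain ⟨z, hz, k, rfl⟩ := hy
    refine Subgroup.subset_closure ⟨z, hz, k + l, ?_⟩
    rw [conj_conj, ← zpow_add, mul_add]
  | one => simp [one_mem]
  | mul y y' _ _ h1 h2 => rw [conj_mul]; exact mul_mem h1 h2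
  | inv y _ h1 => rw [conj_inv]; exact inv_mem h1

theorem RelsHold.commute_even (hR : RelsHold v a t) :
    ∀ x ∈ evenSubgroup m a t, ∀ y ∈ evenSubgroup m a t, Commute x (conj y a⁻¹) := by
  refine commute_conj_of_closure ?_
  rintro _ ⟨x, hx, k, rfl⟩ _ ⟨y, hy, l, rfl⟩
  rw [← commute_conj_iff (h := a ^ (-(2 * k))), conj_conj, conj_conj, conj_conj, ← zpow_add,
    add_neg_cancel, zpow_zero, conj_one_right, ← zpow_neg_one, ← zpow_add, ← zpow_add]
  -- The total exponent is 2l − 1 − 2k = 2(l − k − 1) + 1.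
  have := hR.commute_conj_odd x hx y hy (l - k - 1)
  convert this using 3
  ring

/-- In K(v) this is φ(g) a₁^{-2e(g)} = ⟨g a_n^{-e(g)}, 1⟩: the power of a² removes the right
coordinate. -/
theorem conj_wordEval_mem (hR : RelsHold v a t) (hc : IsGenFamily v (conjHom t) a c) (w : Word m) :
    conj (wordEval c w) t * a ^ (2 * expSum (Fin.last m) w) ∈ evenSubgroup m a t := by
  induction w with
  | nil => simp [one_mem]
  | cons x w ih =>
    rcases x with ⟨i, s⟩
    rw [wordEval_cons, conj_mul, expSum_cons]
    refine Fin.lastCases ?_ (fun j => ?_) i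
    · have hlast := hc.conj_last_iff.2 hR.pow
      cases s
      · have := conj_mem_evenSubgroup ih (-1)
        rw [conj] at this
        simp only [cond_false, conj_inv, hlast, if_true]
        convert this using 1
        group
      · have := conj_mem_evenSubgroup ih 1
        rw [conj] at this
        simp only [cond_true, hlast, if_true]
        convert this using 1
        group
    · rw [if_neg (Fin.castSucc_lt_last j).ne, zero_add, mul_assoc]
      have h := mem_evenSubgroup (hc.conj_castSucc_mem j)
      refine mul_mem ?_ ih
      cases s
      · rw [cond_false, conj_inv]
        exact inv_mem h
      · exact h

/-- The abstract form of g = ⟨g₀, g₁⟩σ^s, where φ(g₀) a^{2e(g₀)} = ⟨g₀ a_n^{-e(g₀)}, 1⟩ and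
φ(g₁)^{a⁻¹} = ⟨a_n^{e(g₁)}, g₁⟩. The balance e(g₁) = e(g₀) + s makes the powers of a_n cancel, and
it is carried along in the induction because the first equality uses it. -/
theorem wordEval_eq (hR : RelsHold v a t) (hc : IsGenFamily v (conjHom t) a c) (w : Word m) :
    (wordEval c w = conj (wordEval c (sec v w false)) t *
      a ^ (2 * expSum (Fin.last m) (sec v w false)) *
      conj (conj (wordEval c (sec v w true)) t) a⁻¹ * (if endState w false = true then a else 1)) ∧
    expSum (Fin.last m) (sec v w true) =
      expSum (Fin.last m) (sec v w false) + if endState w false = true then 1 else 0 := by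
  induction w with
  | nil => simp
  | cons x w ih =>
    rcases x with ⟨i, s⟩
    have hX := conj_wordEval_mem hR hc (sec v w false)
    have hY := conj_wordEval_mem hR hc (sec v w true)
    rw [wordEval_cons, ih.1]
    replace ih := ih.2
    revert ih hX hY
    generalize hA : conj (wordEval c (sec v w false)) t = A
    generalize hB : conj (wordEval c (sec v w true)) t = B
    generalize he : expSum (Fin.last m) (sec v w false) = e
    generalize hf : expSum (Fin.last m) (sec v w true) = f
    intro hX hY ih
    refine Fin.cases ?_ (fun j => ?_) i
    · have hlast := hc.conj_last_iff.2 hR.pow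
      -- Prepending a₁ or its inverse interchanges the two sections, so the left and right factors,
      -- corrected by powers of a², have to be swapped.
      have hXY := (hR.commute_even _ hX _ hY).eq
      rw [conj, inv_inv] at hXY
      rw [endState_zero, endState_not]
      cases hs : endState w false <;> rw [hs] at ih
      · simp only [Bool.false_eq_true, if_false, add_zero] at ih
        subst ih
        cases s
        · simp only [sec_zero, conj_mul, conj_inv, hA, hB, he, hf, hc.zero, hlast, if_true,
            if_false, Bool.false_eq_true, wordEval_cons, expSum_cons,
            cond_false, Bool.not_true, Bool.not_false]
          refine ⟨?_, by ring⟩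
          simp only [conj]
          calc _ = a * (A * a ^ (2 * f) * (a * (B * a ^ (2 * f)) * a⁻¹)) * a ^ (-2 * f) := by
                group
            _ = a * (a * (B * a ^ (2 * f)) * a⁻¹ * (A * a ^ (2 * f))) * a ^ (-2 * f) := by
                rw [hXY]
            _ = _ := by
                group
                simp only [zpow_ofNat, pow_two]
        · simp only [sec_zero, conj_mul, hA, hB, he, hf, hc.zero, hlast, if_true,
            if_false, Bool.false_eq_true, Bool.true_eq_false, wordEval_cons, expSum_cons,
            cond_true, Bool.not_true, Bool.not_false]
          refine ⟨?_, by ring⟩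
          simp only [conj]
          calc _ = a⁻¹ * (A * a ^ (2 * f) * (a * (B * a ^ (2 * f)) * a⁻¹)) * a ^ (-2 * f) := by
                group
            _ = a⁻¹ * (a * (B * a ^ (2 * f)) * a⁻¹ * (A * a ^ (2 * f))) * a ^ (-2 * f) := by
                rw [hXY]
            _ = _ := by group
      · simp only [if_true] at ih
        subst ih
        cases s
        · simp only [sec_zero, conj_mul, conj_inv, hA, hB, he, hf, hc.zero, hlast, if_true,
            if_false, Bool.false_eq_true, wordEval_cons, expSum_cons,
            cond_false, Bool.not_true, Bool.not_false]
          refine ⟨?_, by ring⟩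
          simp only [conj]
          calc _ = a * (A * a ^ (2 * e) * (a * (B * a ^ (2 * (e + 1))) * a⁻¹)) * a ^ (-2 * e - 1) := by
                group
            _ = a * (a * (B * a ^ (2 * (e + 1))) * a⁻¹ * (A * a ^ (2 * e))) * a ^ (-2 * e - 1) := by
                rw [hXY]
            _ = _ := by
                group
                simp only [zpow_ofNat, pow_two]
        · simp only [sec_zero, conj_mul, hA, hB, he, hf, hc.zero, hlast, if_true,
            if_false, Bool.false_eq_true, Bool.true_eq_false, wordEval_cons, expSum_cons,
            cond_true, Bool.not_true, Bool.not_false]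
          refine ⟨?_, by ring⟩
          simp only [conj]
          calc _ = a⁻¹ * (A * a ^ (2 * e) * (a * (B * a ^ (2 * (e + 1))) * a⁻¹)) * a ^ (-2 * e - 1) := by
                group
            _ = a⁻¹ * (a * (B * a ^ (2 * (e + 1))) * a⁻¹ * (A * a ^ (2 * e))) * a ^ (-2 * e - 1) := by
                rw [hXY]
            _ = _ := by group
    · have hmem := mem_evenSubgroup (hc.conj_castSucc_mem j)
      have hj := (Fin.castSucc_lt_last j).ne
      rw [endState_succ]
      cases hv : v j
      · have hcs := hc.succ j
        rw [letterExp_of_false v hv] at hcs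
        refine ⟨?_, ?_⟩
        · cases s <;> simp [sec_succ, hv, conj_mul, conj_inv, hA, hB, he, hj, hcs, mul_assoc]
        · simp [sec_succ, hv, hj, he, hf, ih]
      · have hcs := hc.succ j
        rw [letterExp_of_true v hv] at hcs
        refine ⟨?_, ?_⟩
        -- When x_j = 1 the new letter is a right factor and must be moved past the left one.
        · have key : ∀ y ∈ evenSubgroup m a t, conj y a⁻¹ * (A * a ^ (2 * e) * conj B a⁻¹ *
              (if endState w false = true then a else 1)) =
              A * a ^ (2 * e) * (conj y a⁻¹ * conj B a⁻¹) *
              (if endState w false = true then a else 1) := fun y hy => by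
            rw [mul_assoc (A * _), ← mul_assoc (conj y _), ← (hR.commute_even _ hX _ hy).eq]
            simp only [mul_assoc]
          have hcs' : c j.succ = conj (conj (c j.castSucc) t) a⁻¹ := by
            have e : ∀ g : G, conj g a⁻¹ = a * g * a⁻¹ := fun g => by simp [conj]
            rw [hcs, zpow_one, conjHom_apply, e]
          cases s
          · simpa [sec_succ, hv, conj_mul, conj_inv, hA, hB, he, hcs'] using
              key _ (inv_mem hmem)
          · simpa [sec_succ, hv, conj_mul, conj_inv, hA, hB, he, hcs'] using key _ hmem
        · simp [sec_succ, hv, hj, he, hf, ih]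

end Relations


/-! ### Trivial words die under the relators; the subgroup ⟨a, a^t, …, a^{t^{n-1}}⟩. -/

section Family

variable {G : Type*} [Group G] {m : ℕ} {v : Fin m → Bool}

/-- The family obeying the recursion of the generators of `K(v)`. -/
def genFamily (v : Fin m → Bool) (τ : G →* G) (a : G) (i : Fin (m + 1)) : G :=
  Fin.induction (motive := fun _ => G) a⁻¹
    (fun j g => a ^ letterExp v j * τ g * (a ^ letterExp v j)⁻¹) i

theorem isGenFamily_genFamily (v : Fin m → Bool) (τ : G →* G) (a : G) :
    IsGenFamily v τ a (genFamily v τ a) := ⟨rfl, fun _ => rfl⟩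

theorem IsGenFamily.unique {τ : G →* G} {a : G} {c c' : Fin (m + 1) → G}
    (h : IsGenFamily v τ a c) (h' : IsGenFamily v τ a c') : c = c' := by
  funext i
  rw [h.eq_twist, h'.eq_twist]

theorem IsGenFamily.map {G' : Type*} [Group G'] {τ : G →* G} {τ' : G' →* G'} {a : G}
    {c : Fin (m + 1) → G} (h : IsGenFamily v τ a c) (F : G →* G')
    (hF : ∀ g, F (τ g) = τ' (F g)) : IsGenFamily v τ' (F a) fun i => F (c i) :=
  ⟨by simp [h.zero], fun j => by simp [h.succ, hF]⟩

theorem wordEval_eq_one {a t : G} {c : Fin (m + 1) → G} (hR : RelsHold v a t)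
    (hc : IsGenFamily v (conjHom t) a c) (w : Word m) (hw : wordEval (aut v) w = 1) :
    wordEval c w = 1 := by
  refine trivial_word_induction v (fun w => wordEval c w = 1) rfl ?_ ?_ w hw
  · intro u i s r h
    rwa [wordEval_cancel]
  · intro w hw h0 h1
    rw [(wordEval_eq hR hc w).1, h0, h1, expSum_eq_zero v (sec_trivial v hw false),
      endState_of_trivial v hw]
    simp

/-- The subgroup generated by `a, a^t, …, a^{t^m}`. -/
def fullSubgroup (m : ℕ) (a t : G) : Subgroup G :=
  Subgroup.closure (Set.range fun i : Fin (m + 1) => conj a (t ^ i.val))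

variable {a t : G} {c : Fin (m + 1) → G}

theorem powSubgroup_le : powSubgroup m a t ≤ fullSubgroup m a t := by
  refine (Subgroup.closure_le _).2 ?_
  rintro _ ⟨i, -, hi, rfl⟩
  exact Subgroup.subset_closure ⟨⟨i, hi⟩, rfl⟩

theorem base_mem_fullSubgroup : a ∈ fullSubgroup m a t :=
  Subgroup.subset_closure ⟨0, by simp⟩

/-- Conjugation by t moves each generator to the next, and the last one goes to a^{t^n} = (a²)^P by
the first relator. -/
theorem RelsHold.conj_mem_fullSubgroup (hR : RelsHold v a t) {g : G}
    (hg : g ∈ fullSubgroup m a t) : conj g t ∈ fullSubgroup m a t := by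
  induction hg using Subgroup.closure_induction with
  | mem g hg =>
    obtain ⟨i, rfl⟩ := hg
    refine Fin.lastCases ?_ (fun j => ?_) i
    · have hP : powP v a t ∈ fullSubgroup m a t := powSubgroup_le powP_mem
      simp only [conj_conj, ← pow_succ, Fin.val_last, hR.conj_pow_eq]
      exact mul_mem (mul_mem (inv_mem hP) (pow_mem base_mem_fullSubgroup 2)) hP
    · refine Subgroup.subset_closure ⟨j.succ, ?_⟩
      simp [conj_conj, pow_succ]
  | one => simp [one_mem]
  | mul g g' _ _ h1 h2 => rw [conj_mul]; exact mul_mem h1 h2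
  | inv g _ h1 => rw [conj_inv]; exact inv_mem h1

theorem IsGenFamily.mem_fullSubgroup (hc : IsGenFamily v (conjHom t) a c) (hR : RelsHold v a t)
    (i : Fin (m + 1)) : c i ∈ fullSubgroup m a t := by
  induction i using Fin.induction with
  | zero => rw [hc.zero]; exact inv_mem base_mem_fullSubgroup
  | succ j ih =>
    have ha := zpow_mem (base_mem_fullSubgroup (m := m) (a := a) (t := t)) (letterExp v j)
    rw [hc.succ, conjHom_apply]
    exact mul_mem (mul_mem ha (hR.conj_mem_fullSubgroup ih)) (inv_mem ha)

end Family

/-! ### Finite presentation of Γ. -/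

theorem finite_rels {m : ℕ} (v : Fin m → Bool) : (rels v).Finite := by
  refine ((Set.finite_singleton _).union ?_).union ?_
  · refine (Set.finite_range fun p : Fin (m + 1) × Fin (m + 1) =>
      comm (conj (FreeGroup.of Letter.a) (FreeGroup.of Letter.t ^ p.1.val))
        (conj (FreeGroup.of Letter.a)
          (FreeGroup.of Letter.t ^ p.2.val * FreeGroup.of Letter.a))).subset ?_
    rintro _ ⟨i, j, -, hi, -, hj, rfl⟩
    exact ⟨(⟨i, hi⟩, ⟨j, hj⟩), rfl⟩
  · refine (Set.finite_range fun p : Fin (m + 1) × Fin (m + 1) =>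
      comm (conj (FreeGroup.of Letter.a) (FreeGroup.of Letter.t ^ p.1.val))
        (conj (FreeGroup.of Letter.a)
          (FreeGroup.of Letter.t ^ p.2.val * FreeGroup.of Letter.a ^ 3))).subset ?_
    rintro _ ⟨i, j, -, hi, -, hj, rfl⟩
    exact ⟨(⟨i, hi⟩, ⟨j, hj⟩), rfl⟩

instance : Finite Letter :=
  Finite.of_surjective (fun b : Bool => cond b Letter.a Letter.t) fun x => by
    cases x
    · exact ⟨true, rfl⟩
    · exact ⟨false, rfl⟩

theorem isFinitelyPresented_gam {m : ℕ} (v : Fin m → Bool) :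
    Group.IsFinitelyPresented (Gam v) := by
  have : Finite (rels v) := finite_rels v
  infer_instance

/-! ### The relators hold in the HNN extension. -/

section Extension

variable {m : ℕ} {v : Fin m → Bool} {φ : K v →* K v}

theorem Diag.commute {g h g' k : TreeAut} (H : Diag g h 1) (H' : Diag g' 1 k) :
    Commute g g' := by
  have h1 := H.mul H'
  have h2 := H'.mul H
  rw [mul_one, one_mul] at h1 h2
  exact h1.ext h2

theorem Diag.conj_inv_aut_zero {g h : TreeAut} (H : Diag g h 1) :
    Diag (conj g (aut v 0)⁻¹) 1 (conj h (aut v (Fin.last m))⁻¹) := by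
  intro u
  rw [conj, conj, inv_inv, inv_inv]
  simp only [app_mul, app_aut_zero_false, app_aut_zero_true, (H _).1, (H _).2, app_one]
  refine ⟨app_inv_eq (app_aut_zero_false v u), app_inv_eq ?_⟩
  rw [app_aut_zero_true, ← app_mul _ _ (TreeAut.app _ h), inv_mul_cancel, app_one]

theorem isGenFamily_gen (hφ : ∀ i, φ (gen v i) = phiGen v i) :
    IsGenFamily v φ (gen v 0)⁻¹ (gen v) := by
  refine ⟨(inv_inv _).symm, fun j => ?_⟩
  rw [hφ, phiGen_castSucc]
  cases hv : v j
  · simp [letterExp_of_false v hv]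
  · simp [letterExp_of_true v hv, mul_assoc]

/-- By `IsGenFamily.eq_twist`, φ^i(a₁) is a conjugate of φ(a_i) = ⟨a_i, 1⟩, and conjugating by an
element of the form ⟨*, *⟩ keeps the right coordinate trivial. -/
theorem diag_iterate (hφ : ∀ i, φ (gen v i) = phiGen v i) {i : ℕ} (h1 : 1 ≤ i)
    (h2 : i < m + 1) : ∃ h, Diag (φ^[i] (gen v 0)⁻¹ : K v) h 1 := by
  obtain ⟨j, rfl⟩ : ∃ j : Fin m, i = j.val + 1 := ⟨⟨i - 1, by omega⟩, by simp; omega⟩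
  have e := (isGenFamily_gen hφ).eq_twist j.castSucc
  set x := twist φ (gen v 0)⁻¹ (letterExp v) j.castSucc
  have e' : φ^[j.val + 1] (gen v 0)⁻¹ = (φ x)⁻¹ * (phiGen v j.castSucc)⁻¹ * φ x := by
    rw [Function.iterate_succ_apply', ← hφ, e]
    simp [mul_assoc]
  obtain ⟨k, hk⟩ := diag_phi hφ x
  have hd := (diag_phiGen_castSucc v j).inv
  rw [inv_one] at hd
  rw [e']
  exact ⟨_, hk.conj_one hd⟩

/-- Conjugation by a turns ⟨*, 1⟩ into ⟨1, *⟩, and the further conjugation by a² = ⟨a_n⁻¹, a_n⁻¹⟩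
preserves that shape. -/
theorem commute_iterate (hφ : ∀ i, φ (gen v i) = phiGen v i) {i j : ℕ} (h1 : 1 ≤ i)
    (h2 : i < m + 1) (h3 : 1 ≤ j) (h4 : j < m + 1) :
    Commute (φ^[i] (gen v 0)⁻¹) (conj (φ^[j] (gen v 0)⁻¹) (gen v 0)⁻¹) ∧
    Commute (φ^[i] (gen v 0)⁻¹) (conj (φ^[j] (gen v 0)⁻¹) ((gen v 0)⁻¹ ^ 3)) := by
  obtain ⟨h, hh⟩ := diag_iterate hφ h1 h2
  obtain ⟨k, hk⟩ := diag_iterate hφ h3 h4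
  have hk1 := hk.conj_inv_aut_zero (v := v)
  have ha := (diag_phiGen_last v).inv
  rw [phiGen_last] at ha
  have hk3 := (ha.inv.mul hk1).mul ha
  rw [inv_inv, inv_inv, mul_one, mul_inv_cancel] at hk3
  constructor
  · exact Subtype.ext (hh.commute hk1)
  · have e : ∀ g : K v, conj g ((gen v 0)⁻¹ ^ 3) =
        gen v 0 ^ 2 * conj g (gen v 0)⁻¹ * (gen v 0 ^ 2)⁻¹ := fun g => by
      simp only [conj]
      group
    rw [e]
    exact Subtype.ext (hh.commute hk3)

theorem isGenFamily_of_gen (hφ : ∀ i, φ (gen v i) = phiGen v i)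
    (hinj : Function.Injective φ) :
    IsGenFamily v (conjHom (HNNExtension.t : AscendingHNN φ hinj))
      (HNNExtension.of (gen v 0)⁻¹) fun i => HNNExtension.of (gen v i) :=
  (isGenFamily_gen hφ).map HNNExtension.of fun g => by
    rw [conjHom_apply, AscendingHNN.conj_of]

theorem conj_of_pow (hinj : Function.Injective φ) (g : K v) (k : ℕ) :
    conj (HNNExtension.of g : AscendingHNN φ hinj) (HNNExtension.t ^ k) =
      HNNExtension.of (φ^[k] g) := by
  induction k with
  | zero => simp
  | succ k ih =>
    rw [pow_succ, ← conj_conj, ih, AscendingHNN.conj_of, Function.iterate_succ_apply']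

theorem relsHold_hnn (hφ : ∀ i, φ (gen v i) = phiGen v i) (hinj : Function.Injective φ) :
    RelsHold v (HNNExtension.of (gen v 0)⁻¹ : AscendingHNN φ hinj) HNNExtension.t := by
  refine ⟨?_, fun i j h1 h2 h3 h4 => ?_, fun i j h1 h2 h3 h4 => ?_⟩
  · refine (isGenFamily_of_gen hφ hinj).conj_last_iff.1 ?_
    rw [AscendingHNN.conj_of, hφ, phiGen_last, ← map_zpow, inv_zpow', neg_neg, zpow_ofNat]
  · rw [← conj_conj, conj_of_pow, conj_of_pow, ← map_conj]
    exact (commute_iterate hφ h1 h2 h3 h4).1.map _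
  · rw [← conj_conj, conj_of_pow, conj_of_pow, ← map_pow, ← map_conj]
    exact (commute_iterate hφ h1 h2 h3 h4).2.map _

end Extension

end KneadingGroup

/-! ### The mutually inverse homomorphisms. -/

open KneadingGroup

theorem mainTheorem3 {m : ℕ} (v : Fin m → Bool) :
    ∃ φ : KneadingGroup.K v →* KneadingGroup.K v,
      (φ (KneadingGroup.gen v (Fin.last m)) = KneadingGroup.gen v 0 ^ 2 ∧
        ∀ i : Fin m, φ (KneadingGroup.gen v i.castSucc) =
          if v i = false then KneadingGroup.gen v i.succ
          else KneadingGroup.gen v 0 * KneadingGroup.gen v i.succ * (KneadingGroup.gen v 0)⁻¹) ∧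
      ∃ hφ : Function.Injective φ,
        Group.IsFinitelyPresented (KneadingGroup.Gam v) ∧
        ∃ E : KneadingGroup.Gam v ≃* KneadingGroup.AscendingHNN φ hφ,
          E (KneadingGroup.ga v) = HNNExtension.of (KneadingGroup.gen v 0)⁻¹ ∧
          E (KneadingGroup.gt v) = HNNExtension.t ∧
          ∃ e : KneadingGroup.K v ≃* KneadingGroup.H v,
            ∀ g : KneadingGroup.K v, E (e g : KneadingGroup.Gam v) = HNNExtension.of g := by
  obtain ⟨φ, hφ⟩ := exists_phi v
  have hinj := phi_injective hφ
  refine ⟨φ, ⟨by rw [hφ, phiGen_last], fun i => by rw [hφ, phiGen_castSucc]⟩, hinj,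
    isFinitelyPresented_gam v, ?_⟩
  have hR := relsHold_gam v
  set c := genFamily v (conjHom (gt v)) (ga v)
  have hc : IsGenFamily v (conjHom (gt v)) (ga v) c := isGenFamily_genFamily v _ _
  obtain ⟨κ, hκ⟩ := exists_hom_of_trivial v c (wordEval_eq_one hR hc)
  have hκφ : ∀ g, κ (φ g) = conj (κ g) (gt v) := by
    have : κ.comp φ = (conjHom (gt v)).comp κ := by
      refine hom_ext_gen v fun i => ?_
      simp only [MonoidHom.comp_apply, conjHom_apply, hφ]
      refine Fin.lastCases ?_ (fun j => ?_) i
      · rw [phiGen_last, hκ, hc.conj_last_iff.2 hR.pow, map_pow, hκ, hc.zero]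
        group
      · rw [phiGen_castSucc, hκ]
        have hs := hc.succ j
        cases hv : v j
        · rw [letterExp_of_false v hv] at hs
          simp [hκ, hs]
        · rw [letterExp_of_true v hv] at hs
          simp [hκ, hs, hc.zero, mul_assoc]
    exact fun g => (DFunLike.congr_fun this g).trans (conjHom_apply _ _)
  let f : Letter → AscendingHNN φ hinj := fun x =>
    Letter.casesOn x (HNNExtension.of (gen v 0)⁻¹) HNNExtension.t
  have hf : ∀ r ∈ rels v, FreeGroup.lift f r = 1 := by
    refine (relsHold_iff v (FreeGroup.lift f)).1 ?_
    simpa [f] using relsHold_hnn hφ hinj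
  let F : Gam v →* AscendingHNN φ hinj := PresentedGroup.toGroup hf
  have hFa : F (ga v) = HNNExtension.of (gen v 0)⁻¹ := PresentedGroup.toGroup.of hf
  have hFt : F (gt v) = HNNExtension.t := PresentedGroup.toGroup.of hf
  let F' : AscendingHNN φ hinj →* Gam v := HNNExtension.lift κ (gt v) (by
    rintro ⟨_, g, rfl⟩
    have h : (MonoidHom.ofInjective hinj).symm ⟨φ g, ⟨g, rfl⟩⟩ = g := by
      rw [MulEquiv.symm_apply_eq]
      rfl
    simp only [MulEquiv.trans_apply, h, Subgroup.topEquiv_symm_apply_coe, hκφ, conj]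
    group)
  have hF't : F' HNNExtension.t = gt v := HNNExtension.lift_t _ _ _
  have hF'of : ∀ g, F' (HNNExtension.of g) = κ g := HNNExtension.lift_of _ _ _
  -- `F` sends the family `c` to one with the same recursion and the same starting element as the
  -- generators of K(v) in the extension, and such a family is unique.
  have hFκ : ∀ g, F (κ g) = HNNExtension.of g := by
    have h1 : IsGenFamily v (conjHom HNNExtension.t) (HNNExtension.of (gen v 0)⁻¹)
        fun i => F (c i) := by
      rw [← hFa]
      exact hc.map F fun g => by rw [conjHom_apply, conjHom_apply, map_conj, hFt]
    have h2 := h1.unique (isGenFamily_of_gen hφ hinj)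
    have : F.comp κ = HNNExtension.of := by
      refine hom_ext_gen v fun i => ?_
      rw [MonoidHom.comp_apply, hκ]
      exact congrFun h2 i
    exact DFunLike.congr_fun this
  have hF'F : F'.comp F = MonoidHom.id _ := by
    refine PresentedGroup.ext fun x => ?_
    cases x
    · change F' (F (ga v)) = ga v
      rw [hFa, hF'of, map_inv, hκ, hc.zero, inv_inv]
    · change F' (F (gt v)) = gt v
      rw [hFt, hF't]
  have hFF' : F.comp F' = MonoidHom.id _ := by
    refine HNNExtension.hom_ext ?_ ?_
    · ext g
      simp [hF'of, hFκ]
    · simp [hF't, hFt]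
  -- The base group embeds in its HNN extension, and that embedding factors through `κ`.
  have hκinj : Function.Injective κ := by
    refine Function.Injective.of_comp (f := F) ?_
    have : F ∘ κ = HNNExtension.of := funext hFκ
    rw [this]
    exact HNNExtension.of_injective _
  have hrange : κ.range = H v := by
    apply le_antisymm
    · rintro _ ⟨g, rfl⟩
      obtain ⟨w, rfl⟩ := exists_wordEval_gen v g
      rw [map_wordEval]
      induction w with
      | nil => exact one_mem _
      | cons x w ih =>
        have hx : κ (gen v x.1) ∈ H v := by
          rw [hκ]
          exact hc.mem_fullSubgroup hR x.1
        rw [wordEval_cons]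
        refine mul_mem ?_ ih
        cases x.2
        · exact inv_mem hx
        · exact hx
    · refine (Subgroup.closure_le _).2 ?_
      rintro _ ⟨i, rfl⟩
      -- Since `κ` turns φ into conjugation by t, the i-th iterate at a₁⁻¹ is sent to a^{t^i}.
      refine ⟨φ^[i.val] (gen v 0)⁻¹, ?_⟩
      dsimp only
      generalize i.val = k
      induction k with
      | zero => simp [hκ, hc.zero]
      | succ k ih => rw [Function.iterate_succ_apply', hκφ, ih, conj_conj, pow_succ]
  exact ⟨MonoidHom.toMulEquiv F F' hF'F hFF', hFa, hFt,
    (MonoidHom.ofInjective hκinj).trans (MulEquiv.subgroupCongr hrange), hFκ⟩
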